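/- Let $p\ge 5$ be a prime and let $g\ge 2$ be an integer. Let $$\Sigma_g=\langle a_1,b_1,\dots,a_g,b_g \mid [a_1,b_1]\cdots[a_g,b_g]\rangle,\qquad [a,b]=aba^{-1}b^{-1},$$ be the surface group of genus $g$, i.e. the fundamental group of a closed oriented surface of genus $g$. Then there exist a finite field extension $K$ of the rational function field $\mathbb{F}_p(x,y)$ in two variables and a faithful representation of $\Sigma_g$ into $\mathrm{PGL}_2(K)=\mathrm{GL}_2(K)/K^\times$, that is, an injective group homomorphism $\Sigma_g\to \mathrm{PGL}_2(K)$. -/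

import Mathlib

/-- The relator `[a₀, b₀] [a₁, b₁] ⋯ [a_{g-1}, b_{g-1}]` in the free group on the `2 g` generators
`aᵢ = (i, false)` and `bᵢ = (i, true)`, where `[a, b] = a b a⁻¹ b⁻¹` and the factors are taken in
increasing order of `i`. -/
def surfaceRelator (g : ℕ) : FreeGroup (Fin g × Bool) :=
  (List.ofFn fun i : Fin g =>
    FreeGroup.of (i, false) * FreeGroup.of (i, true) *
      (FreeGroup.of (i, false))⁻¹ * (FreeGroup.of (i, true))⁻¹).prod

/-- The surface group `Σ_g = ⟨a₀, b₀, …, a_{g-1}, b_{g-1} | [a₀, b₀] ⋯ [a_{g-1}, b_{g-1}]⟩`, the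
fundamental group of a closed oriented surface of genus `g`. -/
abbrev SurfaceGroup (g : ℕ) : Type :=
  PresentedGroup ({surfaceRelator g} : Set (FreeGroup (Fin g × Bool)))

/-- The field `F_p(x, y)` of rational functions in two variables over `F_p`. -/
abbrev RationalFunctionField₂ (p : ℕ) [Fact p.Prime] : Type :=
  FractionRing (MvPolynomial (Fin 2) (ZMod p))

/-!
Cut the surface along a separating curve: `Σ_{m+n}` is generated by the images of two free groups,
glued along the cyclic subgroups generated by the relators `r_m` and `r_n⁻¹`. Let `k` be an
algebraically closed field of transcendence degree one over `𝔽_p`, and `y` transcendental over `k`.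

A free group embeds in `SL₂(k)` by conjugating the dilation `diag(z, z⁻¹)` by suitably generic
constant matrices: the leading coefficient in `z` of a nontrivial reduced word does not vanish. In
characteristic `p` unipotent elements are torsion, so in a faithful representation of a torsion-free
group an element `≠ 1` is semisimple with a transcendental eigenvalue. Thus `r_m` and `r_n⁻¹` can be
diagonalized, and, as automorphisms of `k` act transitively on its transcendental elements, both can
be made equal to the same diagonal matrix.

This diagonal matrix commutes with `diag(y, y⁻¹)`, so conjugating the two representations by
`diag(y, y⁻¹)` and by its inverse keeps them compatible. An element that does not commute with the
relator has nonzero off-diagonal entries (otherwise a commutator would be unipotent), so the leading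
coefficient in `y` of its image is a nonzero multiple of a single matrix unit: `e₀₁` on one side
and `e₁₀` on the other. In an alternating product these multiply to something nonzero and singular,
so the product is not scalar. The factors to be excluded are those commuting with the relator, which
are its powers: centralizers in a free group are cyclic, and a map to the Heisenberg group sending
the relator to a generator of the center shows that the relator is not a proper power.

Finitely many matrices over the algebraic closure of `𝔽_p(x, y)` have entries in a finite extension.
-/

open Matrix Polynomial
open scoped MatrixGroups

local notation:1024 "↑ₘ" A:1024 => ((A : SL(2, _)) : Matrix (Fin 2) (Fin 2) _)

section LeadingCoefficients

variable {k K n : Type*} [CommRing k] [CommRing K] [Algebra k K] {z : K}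

/-- `M` is a matrix of Laurent polynomials in `z` over `k` whose degrees are at most some `D`, and
`L` is the matrix of their coefficients in degree `D`. In the encoding `z ^ e • M` has polynomial
entries of degree at most `d = D + e`. The matrix `L` is allowed to vanish. -/
def HasLeadingCoeff (z : K) (M : Matrix n n K) (L : Matrix n n k) : Prop :=
  ∃ (e d : ℕ) (P : Matrix n n k[X]), z ^ e • M = P.map (aeval z) ∧
    ∀ i j, (P i j).natDegree ≤ d ∧ (P i j).coeff d = L i j

lemma hasLeadingCoeff_map (z : K) (L : Matrix n n k) :
    HasLeadingCoeff z (L.map (algebraMap k K)) L :=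
  ⟨0, 0, L.map C, by ext; simp, by simp⟩

variable [Fintype n]

lemma HasLeadingCoeff.mul {M M' : Matrix n n K} {L L' : Matrix n n k}
    (h : HasLeadingCoeff z M L) (h' : HasLeadingCoeff z M' L') :
    HasLeadingCoeff z (M * M') (L * L') := by
  obtain ⟨e, d, P, hM, hP⟩ := h
  obtain ⟨e', d', P', hM', hP'⟩ := h'
  refine ⟨e + e', d + d', P * P', ?_, fun i j => ⟨?_, ?_⟩⟩
  · rw [pow_add, ← smul_mul_smul_comm, hM, hM']
    exact (Matrix.map_mul (f := (aeval z : k[X] →ₐ[k] K))).symm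
  · rw [Matrix.mul_apply]
    exact natDegree_sum_le_of_forall_le _ _ fun l _ =>
      natDegree_mul_le_of_le (hP i l).1 (hP' l j).1
  · simp only [Matrix.mul_apply, finsetSum_coeff]
    refine Finset.sum_congr rfl fun l _ => ?_
    rw [coeff_mul_add_eq_of_natDegree_le (hP i l).1 (hP' l j).1, (hP i l).2, (hP' l j).2]

lemma HasLeadingCoeff.mul_single [DecidableEq n] {M M' : Matrix n n K} {A B A' B' : Matrix n n k}
    {s s' t t' : n} {c : k} (h : HasLeadingCoeff z M (A * single s s' 1 * B))
    (h' : HasLeadingCoeff z M' (A' * single t t' c * B')) :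
    HasLeadingCoeff z (M * M') (A * single s t' ((B * A') s' t * c) * B') := by
  rw [← one_mul ((B * A') s' t), ← single_mul_mul_single]
  simpa only [Matrix.mul_assoc] using h.mul h'

lemma HasLeadingCoeff.exists_eq_scalar [DecidableEq n] (hz : Transcendental k z)
    {M : Matrix n n K} {L : Matrix n n k} (h : HasLeadingCoeff z M L) {r : K}
    (hM : scalar n r = M) : ∃ s, L = scalar n s := by
  obtain ⟨e, d, P, hP, hPL⟩ := h
  have hentry (i j : n) : aeval z (P i j) = if i = j then z ^ e * r else 0 := by
    have := congrFun₂ hP i j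
    rw [map_apply] at this
    rw [← this, ← hM]
    simp [diagonal_apply]
  have hinj := transcendental_iff_injective.mp hz
  have hoff {i j : n} (hij : i ≠ j) : P i j = 0 := hinj (by simp [hentry, hij])
  have hdiag (i j : n) : P i i = P j j := hinj (by simp [hentry])
  obtain hn | ⟨⟨i₀⟩⟩ := isEmpty_or_nonempty n
  · exact ⟨0, Subsingleton.elim _ _⟩
  · refine ⟨L i₀ i₀, ?_⟩
    ext i j
    obtain rfl | hij := eq_or_ne i j
    · simp [← (hPL _ _).2, hdiag i i₀]
    · simp [← (hPL i j).2, hoff hij, hij]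

lemma HasLeadingCoeff.not_mem_center [IsDomain k] [DecidableEq n] (hz : Transcendental k z)
    {A : SpecialLinearGroup n K} {L : Matrix n n k} (h : HasLeadingCoeff z (A : Matrix n n K) L)
    (hL : L ≠ 0) (hdet : L.det = 0) : A ∉ Subgroup.center (SpecialLinearGroup n K) := by
  rw [Matrix.SpecialLinearGroup.mem_center_iff]
  rintro ⟨r, -, hr⟩
  obtain ⟨s, rfl⟩ := h.exists_eq_scalar hz hr
  have hs : s = 0 := by
    rw [scalar_apply, det_diagonal, Finset.prod_const] at hdet
    exact eq_zero_of_pow_eq_zero hdet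
  exact hL (by simp [hs])

end LeadingCoefficients

section Dilation

variable {k K : Type*} [Field k] [Field K] [Algebra k K] {z : K}

lemma ne_zero_of_transcendental (hz : Transcendental k z) : z ≠ 0 :=
  fun h => hz (h ▸ isAlgebraic_zero)

lemma det_single_fin_two (s t : Fin 2) (c : k) : (single s t c).det = 0 := by
  fin_cases s <;> fin_cases t <;> simp [det_fin_two]

lemma HasLeadingCoeff.not_mem_center_of_single
    (hz : Transcendental k z) {A : SL(2, K)} {g h : SL(2, k)} {s t : Fin 2} {c : k}
    (hA : HasLeadingCoeff z ↑ₘA (↑ₘg * single s t c * ↑ₘh)) (hc : c ≠ 0) :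
    A ∉ Subgroup.center SL(2, K) := by
  have isUnit (B : SL(2, k)) : IsUnit (B : Matrix (Fin 2) (Fin 2) k) := by
    simp [isUnit_iff_isUnit_det]
  refine hA.not_mem_center hz (fun hzero => hc ?_) (by simp [det_single_fin_two])
  rw [(isUnit h).mul_left_eq_zero, (isUnit g).mul_right_eq_zero] at hzero
  simpa using congrFun₂ hzero s t

/-- The diagonal matrix of determinant one with entry `z` in place `s` and `z⁻¹` in the other.
Conjugating by it makes the entries of a matrix over `k` grow at different rates in `z`. -/
noncomputable def dilation (z : K) (hz : z ≠ 0) (s : Fin 2) : SL(2, K) :=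
  ![Matrix.SpecialLinearGroup.diag2 z hz, (Matrix.SpecialLinearGroup.diag2 z hz)⁻¹] s

lemma dilation_inv (hz : z ≠ 0) (s : Fin 2) : (dilation z hz s)⁻¹ = dilation z hz s.rev := by
  fin_cases s <;> simp [dilation]

lemma hasLeadingCoeff_dilation (hz : z ≠ 0) (s : Fin 2) :
    HasLeadingCoeff z ↑ₘ(dilation z hz s) (single s s (1 : k)) := by
  refine ⟨1, 2, single s s (X ^ 2) + single s.rev s.rev 1, ?_, fun i j => ?_⟩
  · ext i j
    fin_cases s <;> fin_cases i <;> fin_cases j <;>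
      simp [dilation, Matrix.SpecialLinearGroup.diag2_inv,
        Matrix.SpecialLinearGroup.diag2_coe', hz, sq]
  · fin_cases s <;> fin_cases i <;> fin_cases j <;> simp [coeff_one]

end Dilation

section FreeGroup

variable {k K ι : Type*} [Field k] [Field K] [Algebra k K] {z : K}

/-- The columns of `A` span the lines of slopes `a` and `b`. -/
lemma exists_slopes_eq {a b : k} (hab : a ≠ b) :
    ∃ A : SL(2, k), A 1 0 = a * A 0 0 ∧ A 1 1 = b * A 0 1 ∧ A 0 0 ≠ 0 ∧ A 0 1 ≠ 0 := by
  have hba : b - a ≠ 0 := sub_ne_zero.mpr hab.symm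
  refine ⟨⟨!![1, (b - a)⁻¹; a, b * (b - a)⁻¹], ?_⟩, by simp [hba]⟩
  rw [det_fin_two_of]
  field_simp

lemma exists_pairwise_inv_mul_apply_ne_zero (k ι : Type*) [Field k] [Infinite k] [Countable ι] :
    ∃ g : ι → SL(2, k), Pairwise fun i j => ∀ s t, ((g i)⁻¹ * g j) s t ≠ 0 := by
  obtain ⟨f⟩ : Nonempty (ι × Bool ↪ k) := by
    rw [← Cardinal.lift_mk_le']
    exact (Cardinal.lift_le_aleph0.mpr Cardinal.mk_le_aleph0).trans
      (Cardinal.aleph0_le_lift.mpr (Cardinal.aleph0_le_mk k))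
  choose g h₁₀ h₁₁ h₀₀ h₀₁ using fun i : ι =>
    exists_slopes_eq (f.injective.ne (show (i, false) ≠ (i, true) by simp))
  refine ⟨g, fun i j hij s t => ?_⟩
  have entries : ((g i)⁻¹ * g j : SL(2, k)).1 =
      !![g i 0 1 * g j 0 0 * (f (i, true) - f (j, false)),
          g i 0 1 * g j 0 1 * (f (i, true) - f (j, true));
        g i 0 0 * g j 0 0 * (f (j, false) - f (i, false)),
          g i 0 0 * g j 0 1 * (f (j, true) - f (i, false))] := by
    rw [Matrix.SpecialLinearGroup.coe_mul, Matrix.SpecialLinearGroup.coe_inv, adjugate_fin_two]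
    ext s t
    fin_cases s <;> fin_cases t <;> simp [Matrix.mul_apply, h₁₀, h₁₁] <;> ring
  rw [entries]
  fin_cases s <;> fin_cases t <;> simp [h₀₀, h₀₁, sub_ne_zero, hij, hij.symm]

variable (z) in
lemma hasLeadingCoeff_conj_dilation (hz : z ≠ 0) (g : SL(2, k)) (s : Fin 2) :
    HasLeadingCoeff z ↑ₘ(g.map (algebraMap k K) * dilation z hz s * (g.map (algebraMap k K))⁻¹)
      (↑ₘg * single s s (1 : k) * ↑ₘ(g⁻¹)) := by
  rw [← map_inv]
  exact ((hasLeadingCoeff_map z _).mul (hasLeadingCoeff_dilation hz s)).mul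
    (hasLeadingCoeff_map z _)

lemma hasLeadingCoeff_lift_mk (hz : z ≠ 0) {g : ι → SL(2, k)}
    (hg : Pairwise fun i j => ∀ s t, ((g i)⁻¹ * g j) s t ≠ 0) (i : ι) (b : Bool)
    (w : List (ι × Bool)) (hw : FreeGroup.IsReduced ((i, b) :: w)) :
    ∃ (t : Fin 2) (c : k) (h : SL(2, k)), c ≠ 0 ∧
      HasLeadingCoeff z
        ↑ₘ(FreeGroup.lift (fun i => (g i).map (algebraMap k K) * dilation z hz 0 *
          ((g i).map (algebraMap k K))⁻¹) (FreeGroup.mk ((i, b) :: w)))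
        (↑ₘ(g i) * single (cond b 0 1) t c * ↑ₘh) := by
  set f : ι → SL(2, K) := fun i => (g i).map (algebraMap k K) * dilation z hz 0 *
    ((g i).map (algebraMap k K))⁻¹
  have letter (i : ι) (b : Bool) : HasLeadingCoeff z ↑ₘ(cond b (f i) (f i)⁻¹)
      (↑ₘ(g i) * single (cond b 0 1) (cond b 0 1) (1 : k) * ↑ₘ((g i)⁻¹)) := by
    have := hasLeadingCoeff_conj_dilation z hz (g i) (cond b 0 1)
    cases b
    · simpa [f, mul_assoc, dilation_inv] using this
    · exact this
  induction w generalizing i b with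
  | nil =>
    refine ⟨cond b 0 1, 1, (g i)⁻¹, one_ne_zero, ?_⟩
    simpa [FreeGroup.lift_mk] using letter i b
  | cons x w ih =>
    obtain ⟨i', b'⟩ := x
    obtain ⟨hne, hw⟩ := FreeGroup.isReduced_cons_cons.mp hw
    obtain ⟨t, c, h, hc, hlead⟩ := ih i' b' hw
    refine ⟨t, ((g i)⁻¹ * g i') (cond b 0 1) (cond b' 0 1) * c, h, mul_ne_zero ?_ hc, ?_⟩
    · obtain rfl | hi := eq_or_ne i i'
      · obtain rfl : b = b' := hne rfl
        cases b <;> simp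
      · exact hg hi _ _
    · rw [FreeGroup.lift_mk, List.map_cons, List.prod_cons, ← FreeGroup.lift_mk]
      exact (letter i b).mul_single hlead

theorem exists_injective_freeGroup_of_transcendental [Countable ι] [Infinite k]
    (hz : Transcendental k z) : ∃ φ : FreeGroup ι →* SL(2, K), Function.Injective φ := by
  obtain ⟨g, hg⟩ := exists_pairwise_inv_mul_apply_ne_zero k ι
  refine ⟨FreeGroup.lift fun i => (g i).map (algebraMap k K) *
    dilation z (ne_zero_of_transcendental hz) 0 * ((g i).map (algebraMap k K))⁻¹,
    (injective_iff_map_eq_one _).mpr fun x hx => ?_⟩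
  by_contra hne
  classical
  rw [← FreeGroup.mk_toWord (x := x)] at hx
  have hred := FreeGroup.isReduced_toWord (x := x)
  obtain ⟨⟨i, b⟩, w, hw⟩ := List.exists_cons_of_ne_nil (mt FreeGroup.toWord_eq_nil_iff.mp hne)
  rw [hw] at hx hred
  obtain ⟨t, c, h, hc, hlead⟩ :=
    hasLeadingCoeff_lift_mk (ne_zero_of_transcendental hz) hg i b w hred
  rw [hx] at hlead
  exact hlead.not_mem_center_of_single hz hc (one_mem _)

lemma exists_injective_freeGroup_of_isAlgClosed [Countable ι] [IsAlgClosed K]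
    (hz : Transcendental k z) : ∃ φ : FreeGroup ι →* SL(2, K), Function.Injective φ :=
  have := (algebraicClosure.isAlgClosure k K).isAlgClosed
  have := IsAlgClosed.instInfinite (K := algebraicClosure k K)
  exists_injective_freeGroup_of_transcendental hz.algebraicClosure

end FreeGroup

section AlternatingProduct

variable {G ι : Type*} [Group G] {S : ι → Subgroup G} {C : Subgroup G}

/-- `AlternatingProduct S C s g` says that `g = h₁ * ⋯ * hₙ` with `n ≥ 1`, where each `hᵢ` lies in
`S sᵢ` but not in `C`, consecutive indices `sᵢ` differ, and `s₁ = s`. If the subgroups `S s` all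
contain `C`, these are the nontrivial reduced words of their amalgam over `C`. -/
inductive AlternatingProduct (S : ι → Subgroup G) (C : Subgroup G) : ι → G → Prop
  | of {s : ι} {h : G} (hS : h ∈ S s) (hC : h ∉ C) : AlternatingProduct S C s h
  | mul {s t : ι} {h g : G} (hS : h ∈ S s) (hC : h ∉ C) (hst : s ≠ t)
      (hg : AlternatingProduct S C t g) : AlternatingProduct S C s (h * g)

lemma AlternatingProduct.mul_left (hCS : ∀ s, C ≤ S s) {s : ι} {c g : G} (hc : c ∈ C)
    (hg : AlternatingProduct S C s g) : AlternatingProduct S C s (c * g) := by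
  cases hg with
  | of hS hC => exact .of (mul_mem (hCS s hc) hS) ((C.mul_mem_cancel_left hc).not.mpr hC)
  | mul hS hC hst hg =>
    rw [← mul_assoc]
    exact .mul (mul_mem (hCS s hc) hS) ((C.mul_mem_cancel_left hc).not.mpr hC) hst hg

lemma AlternatingProduct.mem_or_exists_mul (hCS : ∀ s, C ≤ S s) {s t : ι} {h g : G}
    (hh : h ∈ S s) (hg : AlternatingProduct S C t g) :
    h * g ∈ C ∨ ∃ u, AlternatingProduct S C u (h * g) := by
  by_cases hC : h ∈ C
  · exact .inr ⟨t, hg.mul_left hCS hC⟩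
  by_cases hst : s = t
  · subst hst
    cases hg with
    | of hS =>
      by_cases hhg : h * g ∈ C
      · exact .inl hhg
      · exact .inr ⟨s, .of (mul_mem hh hS) hhg⟩
    | @mul _ u h' g' hS _ hsu hg' =>
      rw [← mul_assoc]
      by_cases hhh : h * h' ∈ C
      · exact .inr ⟨u, hg'.mul_left hCS hhh⟩
      · exact .inr ⟨s, .mul (mul_mem hh hS) hhh hsu hg'⟩
  · exact .inr ⟨s, .mul hh hC hst hg⟩

lemma mem_or_exists_alternatingProduct (hCS : ∀ s, C ≤ S s) (hS : ⨆ s, S s = ⊤) (x : G) :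
    x ∈ C ∨ ∃ s, AlternatingProduct S C s x := by
  have step {s : ι} {h g : G} (hh : h ∈ S s) (hg : g ∈ C ∨ ∃ t, AlternatingProduct S C t g) :
      h * g ∈ C ∨ ∃ t, AlternatingProduct S C t (h * g) := by
    obtain hgC | ⟨t, hg⟩ := hg
    · exact (em (h * g ∈ C)).imp_right fun hC => ⟨s, .of (mul_mem hh (hCS s hgC)) hC⟩
    · exact hg.mem_or_exists_mul hCS hh
  have hx : x ∈ Subgroup.closure (⋃ s, (S s : Set G)) := by
    rw [← Subgroup.iSup_eq_closure, hS]
    exact Subgroup.mem_top x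
  induction hx using Subgroup.closure_induction_left with
  | one => exact .inl (one_mem C)
  | mul_left h hh g _ ih =>
    obtain ⟨s, hs⟩ := Set.mem_iUnion.mp hh
    exact step hs ih
  | inv_mul_cancel h hh g _ ih =>
    obtain ⟨s, hs⟩ := Set.mem_iUnion.mp hh
    exact step (inv_mem hs) ih

end AlternatingProduct

section SpecialLinearGroup

lemma specialLinearGroup_map_injective {n R S : Type*} [DecidableEq n] [Fintype n] [CommRing R]
    [CommRing S] {f : R →+* S} (hf : Function.Injective f) :
    Function.Injective (Matrix.SpecialLinearGroup.map (n := n) f) :=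
  fun _ _ h => Subtype.ext (Matrix.map_injective hf (congrArg Subtype.val h))

variable {k K : Type*} [Field k] [Field K]

lemma map_diag2 (f : k →+* K) {l : k} (hl : l ≠ 0) :
    Matrix.SpecialLinearGroup.map f (.diag2 l hl) =
      Matrix.SpecialLinearGroup.diag2 (f l) ((map_ne_zero f).mpr hl) := by
  ext i j
  fin_cases i <;> fin_cases j <;> simp [Matrix.SpecialLinearGroup.diag2_coe']

lemma commute_diag2 {a b : K} (ha : a ≠ 0) (hb : b ≠ 0) :
    Commute (Matrix.SpecialLinearGroup.diag2 a ha) (Matrix.SpecialLinearGroup.diag2 b hb) := by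
  refine Subtype.ext ?_
  simp [Matrix.SpecialLinearGroup.diag2_coe', mul_comm]

end SpecialLinearGroup

section Twist

variable {k K : Type*} [Field k] [Field K] [Algebra k K] {z : K}

/-- The embedding of `SL₂(k)` into `SL₂(K)` conjugated by the diagonal matrix `dilation z hz s`. It
separates the representations of the two sides of an amalgam: the leading coefficients are multiples
of matrix units in opposite corners for `s = 0` and `s = 1`. -/
noncomputable def twist (k : Type*) [Field k] [Algebra k K] (hz : z ≠ 0) (s : Fin 2) :
    SL(2, k) →* SL(2, K) :=
  (MulAut.conj (dilation z hz s)).toMonoidHom.comp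
    (Matrix.SpecialLinearGroup.map (algebraMap k K))

lemma twist_injective (hz : z ≠ 0) (s : Fin 2) : Function.Injective (twist k hz s) :=
  (MulAut.conj _).injective.comp (specialLinearGroup_map_injective (algebraMap k K).injective)

lemma twist_diag2 (hz : z ≠ 0) (s : Fin 2) {l : k} (hl : l ≠ 0) :
    twist k hz s (Matrix.SpecialLinearGroup.diag2 l hl) =
      Matrix.SpecialLinearGroup.diag2 (algebraMap k K l) (by simpa) := by
  have hcomm : Commute (dilation z hz s)
      (Matrix.SpecialLinearGroup.diag2 (algebraMap k K l) (by simpa)) := by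
    fin_cases s
    · exact commute_diag2 hz _
    · exact (commute_diag2 hz _).inv_left
  simp [twist, map_diag2, hcomm.eq]

lemma hasLeadingCoeff_twist (hz : z ≠ 0) (s : Fin 2) (A : SL(2, k)) :
    HasLeadingCoeff z ↑ₘ(twist k hz s A) (single s s.rev (A s s.rev)) := by
  have := ((hasLeadingCoeff_dilation (k := k) hz s).mul
    (hasLeadingCoeff_map z (A : Matrix (Fin 2) (Fin 2) k))).mul
    (hasLeadingCoeff_dilation hz s.rev)
  rw [single_mul_mul_single, one_mul, mul_one, ← dilation_inv] at this
  exact this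

variable {G : Type*} [Group G] {S : Fin 2 → Subgroup G} {C : Subgroup G} {ρ : G →* SL(2, K)}

lemma AlternatingProduct.exists_hasLeadingCoeff
    (hρ : ∀ s, ∀ g ∈ S s, g ∉ C → ∃ c : k, c ≠ 0 ∧ HasLeadingCoeff z ↑ₘ(ρ g) (single s s.rev c))
    {s : Fin 2} {x : G} (hx : AlternatingProduct S C s x) :
    ∃ (t : Fin 2) (c : k), c ≠ 0 ∧ HasLeadingCoeff z ↑ₘ(ρ x) (single s t c) := by
  induction hx with
  | @of s h hS hC => exact ⟨s.rev, hρ s h hS hC⟩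
  | @mul s t h g hS hC hst _ ih =>
    obtain ⟨c, hc, hlead⟩ := hρ s h hS hC
    obtain ⟨u, c', hc', hlead'⟩ := ih
    obtain rfl : t = s.rev := (by decide : ∀ s t : Fin 2, s ≠ t → t = s.rev) s t hst
    refine ⟨u, c * c', mul_ne_zero hc hc', ?_⟩
    rw [map_mul, Matrix.SpecialLinearGroup.coe_mul, ← single_mul_single_same _ s s.rev]
    exact hlead.mul hlead'

/-- A form of Shalen's criterion for a representation of an amalgam to be faithful. -/
theorem eq_one_of_apply_mem_center (hz : Transcendental k z) (hCS : ∀ s, C ≤ S s)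
    (hS : ⨆ s, S s = ⊤)
    (hρ : ∀ s, ∀ g ∈ S s, g ∉ C → ∃ c : k, c ≠ 0 ∧ HasLeadingCoeff z ↑ₘ(ρ g) (single s s.rev c))
    (hC : ∀ g ∈ C, ρ g ∈ Subgroup.center SL(2, K) → g = 1) {x : G}
    (hx : ρ x ∈ Subgroup.center SL(2, K)) : x = 1 := by
  obtain hxC | ⟨s, hs⟩ := mem_or_exists_alternatingProduct hCS hS x
  · exact hC x hxC hx
  · obtain ⟨t, c, hc, hlead⟩ := hs.exists_hasLeadingCoeff hρ
    refine absurd hx (hlead.not_mem_center hz (fun h => hc ?_) (det_single_fin_two s t c))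
    simpa using congrFun₂ h s t

end Twist

section CharP

variable {K : Type*} [Field K]

lemma pow_char_eq_one_of_trace_eq_two (p : ℕ) [Fact p.Prime] [CharP K p] {U : SL(2, K)}
    (hU : U.1.trace = 2) : U ^ p = 1 := by
  have hsq : (U.1 - 1) ^ 2 = 0 := by
    have hcayley := aeval_self_charpoly U.1
    simp only [charpoly_fin_two, hU, U.2, map_add, map_sub, map_mul, map_pow, aeval_X,
      map_one, map_ofNat] at hcayley
    rw [← hcayley]
    noncomm_ring
  have hpow : (U.1 - 1) ^ p = 0 := pow_eq_zero_of_le (Fact.out : p.Prime).two_le hsq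
  rw [sub_pow_char_of_commute p (Commute.one_right _), one_pow, sub_eq_zero] at hpow
  exact Subtype.ext (by simpa using hpow)

lemma trace_mul_diag2_mul_inv_mul_diag2_inv (A : SL(2, K)) {l : K} (hl : l ≠ 0) :
    trace ↑ₘ(A * .diag2 l hl * A⁻¹ * (.diag2 l hl)⁻¹) = 2 - A 0 1 * A 1 0 * (l - l⁻¹) ^ 2 := by
  have hdet := A.det_coe
  rw [det_fin_two] at hdet
  have htrace : trace ↑ₘ(A * .diag2 l hl * A⁻¹ * (.diag2 l hl)⁻¹) =
      (A 0 0 * l * A 1 1 - A 0 1 * l⁻¹ * A 1 0) * l⁻¹ +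
        (A 1 1 * l⁻¹ * A 0 0 - A 1 0 * l * A 0 1) * l := by
    simp [trace_fin_two, adjugate_fin_two, Matrix.SpecialLinearGroup.diag2_coe',
      Matrix.SpecialLinearGroup.diag2_inv, Matrix.mul_apply]
    ring
  rw [htrace]
  field_simp
  linear_combination 2 * l ^ 2 * hdet

variable {F : Type*} [Group F] [IsMulTorsionFree F] {ρ : F →* SL(2, K)}

/-- The commutator of `h` and `c` has trace two, so it is unipotent, which in characteristic `p`
means that its `p`-th power is trivial. -/
lemma commute_of_apply_rev_eq_zero (p : ℕ) [Fact p.Prime] [CharP K p]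
    (hρ : Function.Injective ρ) {c : F} {l : K} {hl : l ≠ 0}
    (hc : ρ c = .diag2 l hl) {h : F} {s : Fin 2} (hh : ρ h s s.rev = 0) : Commute h c := by
  have hzero : ρ h 0 1 * ρ h 1 0 = 0 := by
    fin_cases s
    · exact mul_eq_zero_of_left hh _
    · exact mul_eq_zero_of_right _ hh
  have htrace : trace ↑ₘ(ρ (h * c * h⁻¹ * c⁻¹)) = (2 : K) := by
    simp only [map_mul, map_inv, hc]
    rw [trace_mul_diag2_mul_inv_mul_diag2_inv, hzero, zero_mul, sub_zero]
  have hpow : (h * c * h⁻¹ * c⁻¹) ^ p = 1 :=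
    hρ (by rw [map_pow, pow_char_eq_one_of_trace_eq_two p htrace, map_one])
  rw [pow_eq_one_iff_left (Fact.out : p.Prime).ne_zero] at hpow
  exact commutatorElement_eq_one_iff_commute.mp hpow

end CharP

section Diagonalization

variable {K : Type*} [Field K]

lemma exists_conj_apply_one_zero_eq_zero [IsAlgClosed K] (M : SL(2, K)) :
    ∃ T : SL(2, K), (T * M * T⁻¹) 1 0 = 0 := by
  obtain ⟨μ, hμ⟩ := Module.End.exists_eigenvalue (K := K) (toLin' ↑ₘM)
  obtain ⟨v, hv⟩ := hμ.exists_hasEigenvector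
  have hcoprime : IsCoprime (v 0) (v 1) := by
    by_cases h₀ : v 0 = 0
    · have h₁ : v 1 ≠ 0 := fun h₁ => hv.2 (by ext i; fin_cases i <;> assumption)
      exact isCoprime_one_right.of_isCoprime_of_dvd_right (Ne.isUnit h₁).dvd
    · exact isCoprime_one_left.of_isCoprime_of_dvd_left (Ne.isUnit h₀).dvd
  obtain ⟨g, hg₀, hg₁⟩ := hcoprime.exists_SL2_col 0
  have hMv : ↑ₘM *ᵥ v = μ • v := by simpa using hv.apply_eq_smul
  have hMv₀ := congrFun hMv 0
  have hMv₁ := congrFun hMv 1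
  refine ⟨g⁻¹, ?_⟩
  simp only [mulVec, dotProduct, Fin.sum_univ_two, Pi.smul_apply, smul_eq_mul] at hMv₀ hMv₁
  simp only [Matrix.SpecialLinearGroup.coe_mul, Matrix.SpecialLinearGroup.coe_inv, inv_inv,
    adjugate_fin_two, Matrix.mul_apply, Fin.sum_univ_two, hg₀, hg₁, of_apply, cons_val_zero,
    cons_val_one, cons_val_fin_one]
  linear_combination v 0 * hMv₁ - v 1 * hMv₀

lemma mul_apply_eq_one_of_apply_one_zero_eq_zero {U : SL(2, K)} (h₁₀ : U 1 0 = 0) :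
    U 0 0 * U 1 1 = 1 := by
  have hdet := U.det_coe
  rwa [det_fin_two, h₁₀, mul_zero, sub_zero] at hdet

lemma exists_conj_eq_diag2 {U : SL(2, K)} (h₁₀ : U 1 0 = 0) (hne : U 0 0 ≠ U 1 1) :
    ∃ (T : SL(2, K)) (hl : U 0 0 ≠ 0), T * U * T⁻¹ = .diag2 (U 0 0) hl := by
  have hdet : U 0 0 * U 1 1 = 1 := mul_apply_eq_one_of_apply_one_zero_eq_zero h₁₀
  have hsub : U 0 0 - U 1 1 ≠ 0 := sub_ne_zero.mpr hne
  refine ⟨.transvection zero_ne_one (U 0 1 / (U 0 0 - U 1 1)), left_ne_zero_of_mul_eq_one hdet, ?_⟩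
  rw [mul_inv_eq_iff_eq_mul]
  refine Subtype.ext ?_
  rw [Matrix.SpecialLinearGroup.coe_mul, Matrix.SpecialLinearGroup.coe_mul,
    Matrix.SpecialLinearGroup.transvection_coe, Matrix.SpecialLinearGroup.diag2_coe']
  have h₁₁ : U 1 1 = (U 0 0)⁻¹ := eq_inv_of_mul_eq_one_right hdet
  have h₀₁ : U 0 1 + U 0 1 / (U 0 0 - U 1 1) * U 1 1 = U 0 0 * (U 0 1 / (U 0 0 - U 1 1)) := by
    field_simp
    ring
  ext i j
  fin_cases i <;> fin_cases j
  · simp [Matrix.mul_apply, h₁₀]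
  · simpa [Matrix.mul_apply] using h₀₁
  · simp [Matrix.mul_apply, h₁₀]
  · simpa [Matrix.mul_apply] using h₁₁

lemma pow_apply_of_apply_one_zero_eq_zero {U : SL(2, K)} (h₁₀ : U 1 0 = 0) (m : ℕ) :
    (U ^ m) 0 0 = U 0 0 ^ m ∧ (U ^ m) 1 0 = 0 := by
  induction m with
  | zero => simp
  | succ m ih =>
    rw [pow_succ]
    simp only [Matrix.SpecialLinearGroup.coe_mul, Matrix.mul_apply, Fin.sum_univ_two, h₁₀, ih]
    simp [pow_succ]

variable {p : ℕ} [Fact p.Prime]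

lemma pow_mul_char_eq_one_of_apply_one_zero_eq_zero [CharP K p] {U : SL(2, K)} (h₁₀ : U 1 0 = 0)
    {m : ℕ} (hm : U 0 0 ^ m = 1) : U ^ (m * p) = 1 := by
  obtain ⟨h₀₀', h₁₀'⟩ := pow_apply_of_apply_one_zero_eq_zero h₁₀ m
  have h₁₁' : (U ^ m) 1 1 = 1 := by
    simpa only [h₀₀', hm, one_mul] using mul_apply_eq_one_of_apply_one_zero_eq_zero h₁₀'
  rw [pow_mul]
  refine pow_char_eq_one_of_trace_eq_two p ?_
  rw [trace_fin_two, h₀₀', hm, h₁₁', one_add_one_eq_two]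

lemma exists_pow_eq_one_of_isAlgebraic_zmod [Algebra (ZMod p) K] {l : K} (hl : l ≠ 0)
    (halg : IsAlgebraic (ZMod p) l) : ∃ m ≠ 0, l ^ m = 1 := by
  have := IntermediateField.adjoin.finiteDimensional halg.isIntegral
  have : Finite (IntermediateField.adjoin (ZMod p) {l}) := Module.finite_of_finite (ZMod p)
  let l' := IntermediateField.AdjoinSimple.gen (ZMod p) l
  have hfin : IsOfFinOrder (Units.mk0 l' (by simpa [l', Subtype.ext_iff] using hl)) :=
    isOfFinOrder_of_finite _
  obtain ⟨m, hm, hpow⟩ := isOfFinOrder_iff_pow_eq_one.mp hfin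
  refine ⟨m, hm.ne', ?_⟩
  simpa [l', Units.ext_iff, Subtype.ext_iff] using hpow

variable {F : Type*} [Group F] [IsMulTorsionFree F]

theorem exists_injective_apply_eq_diag2 [IsAlgClosed K] [Algebra (ZMod p) K] {ρ : F →* SL(2, K)}
    (hρ : Function.Injective ρ) {c : F} (hc : c ≠ 1) :
    ∃ (ρ' : F →* SL(2, K)) (l : K) (hl : l ≠ 0), Function.Injective ρ' ∧
      Transcendental (ZMod p) l ∧ ρ' c = .diag2 l hl := by
  have := charP_of_injective_algebraMap (algebraMap (ZMod p) K).injective p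
  obtain ⟨T, hT⟩ := exists_conj_apply_one_zero_eq_zero (ρ c)
  set U := T * ρ c * T⁻¹
  have hdet : U 0 0 * U 1 1 = 1 := mul_apply_eq_one_of_apply_one_zero_eq_zero hT
  have hρT : Function.Injective ((MulAut.conj T).toMonoidHom.comp ρ) :=
    (MulAut.conj T).injective.comp hρ
  have htrans : Transcendental (ZMod p) (U 0 0) := by
    intro halg
    obtain ⟨m, hm, hpow⟩ :=
      exists_pow_eq_one_of_isAlgebraic_zmod (left_ne_zero_of_mul_eq_one hdet) halg
    have hcpow : c ^ (m * p) = 1 := hρT <| by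
      rw [map_pow, map_one]
      exact pow_mul_char_eq_one_of_apply_one_zero_eq_zero hT hpow
    rw [pow_eq_one_iff_left (mul_ne_zero hm (Fact.out : p.Prime).ne_zero)] at hcpow
    exact hc hcpow
  have hne : U 0 0 ≠ U 1 1 := by
    intro h
    rw [← h, ← sq] at hdet
    exact htrans (.of_pow two_pos (by rw [hdet]; exact isAlgebraic_one))
  obtain ⟨T', hl, hT'⟩ := exists_conj_eq_diag2 hT hne
  exact ⟨(MulAut.conj T').toMonoidHom.comp ((MulAut.conj T).toMonoidHom.comp ρ), U 0 0, hl,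
    (MulAut.conj T').injective.comp hρT, htrans, hT'⟩

end Diagonalization

section Center

lemma eq_one_of_apply_mem_center_of_injective {K F : Type*} [Field K] [Group F]
    [IsMulTorsionFree F] {ρ : F →* SL(2, K)} (hρ : Function.Injective ρ) {a : F}
    (ha : ρ a ∈ Subgroup.center SL(2, K)) : a = 1 := by
  obtain ⟨r, hr, hscalar⟩ := Matrix.SpecialLinearGroup.mem_center_iff.mp ha
  have hsq : a ^ 2 = 1 := hρ <| Subtype.ext <| by
    rw [map_pow, map_one, Matrix.SpecialLinearGroup.coe_pow, ← hscalar, ← map_pow]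
    simpa using congrArg (scalar (Fin 2)) hr
  exact (pow_eq_one_iff_left two_ne_zero).mp hsq

end Center

section Fields

lemma exists_ringHom_apply_eq {F k : Type*} [Field F] [Field k] [Algebra F k] [IsAlgClosed k]
    (htr : Algebra.trdeg F k ≤ 1) {l m : k} (hl : Transcendental F l) (hm : Transcendental F m) :
    ∃ σ : k →+* k, σ l = m := by
  have isTranscendenceBasis {x : k} (hx : Transcendental F x) :
      IsTranscendenceBasis F fun _ : PUnit => x :=
    (algebraicIndependent_unique_type_iff.mpr hx).isTranscendenceBasis_of_trdeg_le_of_finite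
      (by simpa using htr)
  have basis_l := isTranscendenceBasis hl
  have basis_m := isTranscendenceBasis hm
  have := IsAlgClosed.isAlgClosure_of_transcendence_basis _ basis_l
  have := IsAlgClosed.isAlgClosure_of_transcendence_basis _ basis_m
  let e := (basis_l.1.aevalEquiv.symm.trans basis_m.1.aevalEquiv).toRingEquiv
  refine ⟨(IsAlgClosure.equivOfEquiv k k e).toRingHom, ?_⟩
  have h := IsAlgClosure.equivOfEquiv_algebraMap k k e
    (basis_l.1.aevalEquiv (MvPolynomial.X PUnit.unit))
  simpa [e] using h

universe u in
lemma trdeg_eq_of_isAlgebraic (F : Type*) {L k : Type u} [Field F] [Field L] [Field k]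
    [Algebra F L] [Algebra L k] [Algebra F k] [IsScalarTower F L k] [Algebra.IsAlgebraic L k] :
    Algebra.trdeg F k = Algebra.trdeg F L := by
  rw [← trdeg_add_eq F L (A := k), trdeg_eq_zero (R := L), add_zero]

open scoped IntermediateField in
lemma trdeg_adjoin_simple_le_one {F Ω : Type*} [Field F] [Field Ω] [Algebra F Ω] (x : Ω) :
    Algebra.trdeg F F⟮x⟯ ≤ 1 := by
  let gen := IntermediateField.AdjoinSimple.gen F x
  have hgen : F⟮gen⟯ = ⊤ := IntermediateField.lift_injective _ <| by
    rw [IntermediateField.lift_adjoin_simple, IntermediateField.lift_top,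
      IntermediateField.AdjoinSimple.coe_gen]
  have : Algebra.IsAlgebraic F⟮gen⟯ F⟮x⟯ :=
    ⟨fun a => isAlgebraic_algebraMap (⟨a, hgen ▸ IntermediateField.mem_top⟩ : F⟮gen⟯)⟩
  have : Algebra.IsAlgebraic (Algebra.adjoin F {gen}) F⟮x⟯ :=
    IntermediateField.isAlgebraic_adjoin_iff_top.mp this
  simpa using Algebra.IsAlgebraic.trdeg_le_cardinalMk F {gen}

lemma exists_isAlgClosed_trdeg_le_one {F Ω : Type*} [Field F] [Field Ω] [Algebra F Ω]
    [IsAlgClosed Ω] {v : Fin 2 → Ω} (h : AlgebraicIndependent F v) :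
    ∃ k : IntermediateField F Ω, IsAlgClosed k ∧ Algebra.trdeg F k ≤ 1 ∧
      (∃ x : k, Transcendental F x) ∧ Transcendental k (v 1) := by
  let L := IntermediateField.adjoin F {v 0}
  have hy : Transcendental L (v 1) := by
    have hadjoin := ((AlgebraicIndependent.iff_transcendental_adjoin_image (1 : Fin 2)).mp h).2
    have hcompl : ({1}ᶜ : Set (Fin 2)) = {0} := by ext i; fin_cases i <;> simp
    rwa [hcompl, Set.image_singleton, ← IntermediateField.transcendental_adjoin_iff] at hadjoin
  let k := (algebraicClosure L Ω).restrictScalars F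
  let x' : k := algebraMap L (algebraicClosure L Ω) (IntermediateField.AdjoinSimple.gen F (v 0))
  refine ⟨k, (algebraicClosure.isAlgClosure L Ω).isAlgClosed, ?_, ⟨x', ?_⟩, hy.algebraicClosure⟩
  · exact (trdeg_eq_of_isAlgebraic F (L := L) (k := algebraicClosure L Ω)).trans_le
      (trdeg_adjoin_simple_le_one (v 0))
  · rw [← transcendental_algebraMap_iff (algebraMap k Ω).injective]
    exact h.transcendental 0

end Fields

section CommutingElements

lemma eq_of_commute_of {α : Type*} {i j : α} (h : Commute (FreeGroup.of i) (FreeGroup.of j)) :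
    i = j := by
  classical
  by_contra hij
  let f : α → Equiv.Perm (Fin 3) := fun l => if l = i then Equiv.swap 0 1 else Equiv.swap 1 2
  have hf : Commute (f i) (f j) := by simpa using h.map (FreeGroup.lift f)
  have hfi : f i = Equiv.swap 0 1 := if_pos rfl
  have hfj : f j = Equiv.swap 1 2 := if_neg (Ne.symm hij)
  rw [hfi, hfj] at hf
  exact absurd hf.eq (by decide)

variable {G : Type*} [Group G] [IsFreeGroup G]

lemma isCyclic_of_forall_commute (h : ∀ x y : G, Commute x y) : IsCyclic G := by
  let e := IsFreeGroup.toFreeGroup G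
  have : Subsingleton (IsFreeGroup.Generators G) :=
    ⟨fun i j => eq_of_commute_of <| by
      simpa using (h (e.symm (FreeGroup.of i)) (e.symm (FreeGroup.of j))).map e⟩
  rw [e.isCyclic]
  obtain _ | ⟨⟨i⟩⟩ := isEmpty_or_nonempty (IsFreeGroup.Generators G)
  · infer_instance
  · have := uniqueOfSubsingleton i
    infer_instance

lemma exists_mem_zpowers_of_commute {a b : G} (h : Commute a b) :
    ∃ r, a ∈ Subgroup.zpowers r ∧ b ∈ Subgroup.zpowers r := by
  let S := Subgroup.closure ({a, b} : Set G)
  have hS : IsMulCommutative S := Subgroup.isMulCommutative_closure (by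
    rintro x (rfl | rfl) y (rfl | rfl)
    exacts [rfl, h, h.symm, rfl])
  have := isCyclic_of_forall_commute (G := S) mul_comm'
  obtain ⟨r, hr⟩ := (S.isCyclic_iff_exists_zpowers_eq_top).mp this
  exact ⟨r, hr ▸ Subgroup.subset_closure (by simp), hr ▸ Subgroup.subset_closure (by simp)⟩

end CommutingElements

/-- The integral Heisenberg group: `⟨x, y, w⟩` stands for the upper unitriangular `3 × 3` matrix
with `x`, `y` above the diagonal and `w` in the corner. In it a commutator can be a generator of
the center that is not a proper power, which detects that the surface relator is not one. -/
@[ext] structure Heisenberg where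
  x : ℤ
  y : ℤ
  w : ℤ

namespace Heisenberg

instance : Mul Heisenberg := ⟨fun a b => ⟨a.x + b.x, a.y + b.y, a.w + b.w + a.x * b.y⟩⟩
instance : One Heisenberg := ⟨⟨0, 0, 0⟩⟩
instance : Inv Heisenberg := ⟨fun a => ⟨-a.x, -a.y, -a.w + a.x * a.y⟩⟩

@[simp] lemma mul_x (a b : Heisenberg) : (a * b).x = a.x + b.x := rfl
@[simp] lemma mul_y (a b : Heisenberg) : (a * b).y = a.y + b.y := rfl
@[simp] lemma mul_w (a b : Heisenberg) : (a * b).w = a.w + b.w + a.x * b.y := rfl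
@[simp] lemma one_x : (1 : Heisenberg).x = 0 := rfl
@[simp] lemma one_y : (1 : Heisenberg).y = 0 := rfl
@[simp] lemma one_w : (1 : Heisenberg).w = 0 := rfl
@[simp] lemma inv_x (a : Heisenberg) : a⁻¹.x = -a.x := rfl
@[simp] lemma inv_y (a : Heisenberg) : a⁻¹.y = -a.y := rfl
@[simp] lemma inv_w (a : Heisenberg) : a⁻¹.w = -a.w + a.x * a.y := rfl

instance : Group Heisenberg :=
  Group.ofLeftAxioms (fun a b c => by ext <;> simp <;> ring) (fun a => by ext <;> simp)
    (fun a => by ext <;> simp)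

lemma pow_x (a : Heisenberg) (n : ℕ) : (a ^ n).x = n * a.x := by
  induction n with
  | zero => simp
  | succ n ih => rw [pow_succ, mul_x, ih]; push_cast; ring

lemma pow_w {a : Heisenberg} (ha : a.x = 0) (n : ℕ) : (a ^ n).w = n * a.w := by
  induction n with
  | zero => simp
  | succ n ih => rw [pow_succ, mul_w, ih, pow_x, ha]; push_cast; ring

lemma eq_one_of_pow_eq {a : Heisenberg} {n : ℕ} (h : a ^ n = ⟨0, 0, 1⟩) : n = 1 := by
  have hn : n ≠ 0 := by
    rintro rfl
    simpa using congrArg w h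
  have hx : a.x = 0 := by
    have := congrArg x h
    rw [pow_x] at this
    simpa [hn] using this
  have hw : n * a.w = 1 := pow_w hx n ▸ congrArg w h
  exact_mod_cast Int.eq_one_of_dvd_one n.cast_nonneg ⟨a.w, hw.symm⟩

lemma mem_zpowers_of_zpow_eq {G : Type*} [Group G] (φ : G →* Heisenberg) {r c : G} {m : ℤ}
    (hφ : φ c = ⟨0, 0, 1⟩) (hm : r ^ m = c) : r ∈ Subgroup.zpowers c := by
  rw [← hm, map_zpow] at hφ
  obtain ⟨n, rfl | rfl⟩ := m.eq_nat_or_neg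
  · obtain rfl := eq_one_of_pow_eq ((zpow_natCast _ _).symm.trans hφ)
    simp [← hm]
  · have hφ' : (φ r)⁻¹ ^ n = ⟨0, 0, 1⟩ := by simpa using hφ
    obtain rfl := eq_one_of_pow_eq hφ'
    simp [← hm]

lemma exists_map_surfaceRelator (g : ℕ) :
    ∃ φ : FreeGroup (Fin (g + 1) × Bool) →* Heisenberg,
      φ (surfaceRelator (g + 1)) = ⟨0, 0, 1⟩ := by
  let f : Fin (g + 1) × Bool → Heisenberg := fun q =>
    if q.1 = 0 then (if q.2 then ⟨0, 1, 0⟩ else ⟨1, 0, 0⟩) else 1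
  refine ⟨FreeGroup.lift f, ?_⟩
  ext <;> simp [surfaceRelator, List.ofFn_succ, map_list_prod, List.map_ofFn, Function.comp_def, f]

end Heisenberg

lemma surfaceRelator_ne_one {g : ℕ} (hg : g ≠ 0) : surfaceRelator g ≠ 1 := by
  obtain ⟨n, rfl⟩ := Nat.exists_eq_succ_of_ne_zero hg
  obtain ⟨φ, hφ⟩ := Heisenberg.exists_map_surfaceRelator n
  intro h
  rw [h, map_one] at hφ
  simpa using congrArg Heisenberg.w hφ

lemma mem_zpowers_of_commute_surfaceRelator {g : ℕ} (hg : g ≠ 0)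
    {h : FreeGroup (Fin g × Bool)} (hc : Commute h (surfaceRelator g)) :
    h ∈ Subgroup.zpowers (surfaceRelator g) := by
  obtain ⟨n, rfl⟩ := Nat.exists_eq_succ_of_ne_zero hg
  obtain ⟨r, hr, m, hm⟩ := exists_mem_zpowers_of_commute hc
  obtain ⟨φ, hφ⟩ := Heisenberg.exists_map_surfaceRelator n
  exact Subgroup.zpowers_le.mpr (Heisenberg.mem_zpowers_of_zpow_eq φ hφ hm) hr

section Splitting

lemma surfaceRelator_add (m n : ℕ) :
    surfaceRelator (m + n) =
      FreeGroup.map (Prod.map (Fin.castAdd n) id) (surfaceRelator m) *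
        FreeGroup.map (Prod.map (Fin.natAdd m) id) (surfaceRelator n) := by
  simp only [surfaceRelator, List.ofFn_add, List.prod_append, map_list_prod, List.map_ofFn]
  rfl

namespace SurfaceGroup

/-- The map from the free group `⟨a₀, b₀, …, a_{m-1}, b_{m-1}⟩`, the fundamental group of the genus
`m` part of a surface of genus `m + n` cut along a separating curve. -/
def left (m n : ℕ) : FreeGroup (Fin m × Bool) →* SurfaceGroup (m + n) :=
  (PresentedGroup.mk _).comp (FreeGroup.map (Prod.map (Fin.castAdd n) id))

/-- The map from the free group on the last `n` pairs of generators, the fundamental group of the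
genus `n` part of a surface of genus `m + n` cut along a separating curve. -/
def right (m n : ℕ) : FreeGroup (Fin n × Bool) →* SurfaceGroup (m + n) :=
  (PresentedGroup.mk _).comp (FreeGroup.map (Prod.map (Fin.natAdd m) id))

variable (m n : ℕ)

lemma left_mul_right : left m n (surfaceRelator m) * right m n (surfaceRelator n) = 1 := by
  rw [left, right, MonoidHom.comp_apply, MonoidHom.comp_apply, ← map_mul, ← surfaceRelator_add]
  exact PresentedGroup.one_of_mem rfl

lemma map_left_zpowers_surfaceRelator :
    (Subgroup.zpowers (surfaceRelator m)).map (left m n) =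
      (Subgroup.zpowers (surfaceRelator n)).map (right m n) := by
  rw [MonoidHom.map_zpowers, MonoidHom.map_zpowers, eq_inv_of_mul_eq_one_left (left_mul_right m n),
    Subgroup.zpowers_inv]

lemma range_left_sup_range_right : (left m n).range ⊔ (right m n).range = ⊤ := by
  rw [eq_top_iff, ← PresentedGroup.closure_range_of, Subgroup.closure_le]
  rintro _ ⟨⟨i, b⟩, rfl⟩
  cases i using Fin.addCases with
  | left i => exact Subgroup.mem_sup_left ⟨FreeGroup.of (i, b), rfl⟩
  | right i => exact Subgroup.mem_sup_right ⟨FreeGroup.of (i, b), rfl⟩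

variable {m n}

lemma exists_lift {G : Type*} [Group G] {φ : FreeGroup (Fin m × Bool) →* G}
    {ψ : FreeGroup (Fin n × Bool) →* G} (h : φ (surfaceRelator m) * ψ (surfaceRelator n) = 1) :
    ∃ ρ : SurfaceGroup (m + n) →* G,
      (∀ w, ρ (left m n w) = φ w) ∧ ∀ w, ρ (right m n w) = ψ w := by
  let f : Fin (m + n) × Bool → G := fun q =>
    Fin.addCases (fun i => φ (FreeGroup.of (i, q.2))) (fun i => ψ (FreeGroup.of (i, q.2))) q.1
  have hφ : (FreeGroup.lift f).comp (FreeGroup.map (Prod.map (Fin.castAdd n) id)) = φ :=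
    FreeGroup.ext_hom _ _ fun q => by simp [f]
  have hψ : (FreeGroup.lift f).comp (FreeGroup.map (Prod.map (Fin.natAdd m) id)) = ψ :=
    FreeGroup.ext_hom _ _ fun q => by simp [f]
  have hrel : ∀ r ∈ ({surfaceRelator (m + n)} : Set _), FreeGroup.lift f r = 1 := by
    rintro r rfl
    rw [surfaceRelator_add, map_mul, ← MonoidHom.comp_apply, hφ, ← MonoidHom.comp_apply, hψ, h]
  exact ⟨PresentedGroup.toGroup hrel, DFunLike.congr_fun hφ, DFunLike.congr_fun hψ⟩

end SurfaceGroup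

end Splitting

section Representation

lemma exists_hasLeadingCoeff_twist (p : ℕ) [Fact p.Prime] {k K F : Type*} [Field k] [CharP k p]
    [Field K] [Algebra k K] [Group F] [IsMulTorsionFree F] {z : K} (hz : z ≠ 0) (s : Fin 2)
    {φ : F →* SL(2, k)} (hφ : Function.Injective φ) {c : F} {l : k} {hl : l ≠ 0}
    (hc : φ c = .diag2 l hl) {w : F} (hw : ¬ Commute w c) :
    ∃ a : k, a ≠ 0 ∧ HasLeadingCoeff z ↑ₘ(twist k hz s (φ w)) (single s s.rev a) :=
  ⟨φ w s s.rev, fun h => hw (commute_of_apply_rev_eq_zero p hφ hc h),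
    hasLeadingCoeff_twist hz s (φ w)⟩

lemma SurfaceGroup.eq_one_of_apply_mem_center (p : ℕ) [Fact p.Prime] {k K : Type*} [Field k]
    [CharP k p] [Field K] [Algebra k K] {y : K} (hy : Transcendental k y) (hy₀ : y ≠ 0) {m n : ℕ}
    (hm : m ≠ 0) (hn : n ≠ 0) {φ : FreeGroup (Fin m × Bool) →* SL(2, k)}
    {ψ : FreeGroup (Fin n × Bool) →* SL(2, k)} (hφ : Function.Injective φ)
    (hψ : Function.Injective ψ) {l : k} {hl : l ≠ 0} (hφl : φ (surfaceRelator m) = .diag2 l hl)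
    (hψl : ψ (surfaceRelator n)⁻¹ = .diag2 l hl) {ρ : SurfaceGroup (m + n) →* SL(2, K)}
    (hleft : ∀ w, ρ (left m n w) = twist k hy₀ 0 (φ w))
    (hright : ∀ w, ρ (right m n w) = twist k hy₀ 1 (ψ w)) {x : SurfaceGroup (m + n)}
    (hx : ρ x ∈ Subgroup.center SL(2, K)) : x = 1 := by
  let C := (Subgroup.zpowers (surfaceRelator m)).map (left m n)
  refine _root_.eq_one_of_apply_mem_center (C := C) (S := ![(left m n).range, (right m n).range])
    hy (Fin.forall_fin_two.mpr ⟨?_, ?_⟩) ?_ (Fin.forall_fin_two.mpr ⟨?_, ?_⟩) ?_ hx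
  · exact Subgroup.map_le_range _ _
  · exact (map_left_zpowers_surfaceRelator m n).trans_le (Subgroup.map_le_range _ _)
  · simpa [iSup, sup_comm] using range_left_sup_range_right m n
  · rintro _ ⟨w, rfl⟩ hwC
    rw [hleft]
    refine exists_hasLeadingCoeff_twist p hy₀ 0 hφ hφl fun hcomm => hwC ?_
    exact ⟨w, mem_zpowers_of_commute_surfaceRelator hm hcomm, rfl⟩
  · rintro _ ⟨w, rfl⟩ hwC
    rw [hright]
    refine exists_hasLeadingCoeff_twist p hy₀ 1 hψ hψl fun hcomm => hwC ?_
    have hw := mem_zpowers_of_commute_surfaceRelator hn (Commute.inv_right_iff.mp hcomm)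
    exact (map_left_zpowers_surfaceRelator m n).ge ⟨w, hw, rfl⟩
  · rintro _ ⟨w, -, rfl⟩ hcenter
    rw [hleft] at hcenter
    have hinj := (twist_injective hy₀ 0).comp hφ
    rw [eq_one_of_apply_mem_center_of_injective (ρ := (twist k hy₀ 0).comp φ) hinj hcenter,
      map_one]

variable {k K : Type*} [Field k] [IsAlgClosed k] {p : ℕ} [Fact p.Prime] [Algebra (ZMod p) k]

lemma exists_injective_pair_apply_eq_diag2 (htr : Algebra.trdeg (ZMod p) k ≤ 1) {x : k}
    (hx : Transcendental (ZMod p) x) {ι κ : Type*} [Countable ι] [Countable κ]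
    {c : FreeGroup ι} (hc : c ≠ 1) {d : FreeGroup κ} (hd : d ≠ 1) :
    ∃ (φ : FreeGroup ι →* SL(2, k)) (ψ : FreeGroup κ →* SL(2, k)) (l : k) (hl : l ≠ 0),
      Function.Injective φ ∧ Function.Injective ψ ∧ φ c = .diag2 l hl ∧ ψ d = .diag2 l hl := by
  obtain ⟨φ₀, hφ₀⟩ := exists_injective_freeGroup_of_isAlgClosed (ι := ι) hx
  obtain ⟨ψ₀, hψ₀⟩ := exists_injective_freeGroup_of_isAlgClosed (ι := κ) hx
  obtain ⟨φ, l, hl, hφ, hltr, hφc⟩ := exists_injective_apply_eq_diag2 (p := p) hφ₀ hc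
  obtain ⟨ψ, m, hm, hψ, hmtr, hψd⟩ := exists_injective_apply_eq_diag2 (p := p) hψ₀ hd
  obtain ⟨σ, rfl⟩ := exists_ringHom_apply_eq htr hltr hmtr
  refine ⟨(Matrix.SpecialLinearGroup.map σ).comp φ, ψ, σ l, hm, ?_, hψ, ?_, hψd⟩
  · exact (specialLinearGroup_map_injective σ.injective).comp hφ
  · rw [MonoidHom.comp_apply, hφc, map_diag2]

theorem exists_surfaceGroup_hom [Field K] [Algebra k K] (htr : Algebra.trdeg (ZMod p) k ≤ 1)
    {x : k} (hx : Transcendental (ZMod p) x) {y : K} (hy : Transcendental k y)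
    {m n : ℕ} (hm : m ≠ 0) (hn : n ≠ 0) :
    ∃ ρ : SurfaceGroup (m + n) →* SL(2, K),
      ∀ w, ρ w ∈ Subgroup.center SL(2, K) → w = 1 := by
  have : CharP k p := charP_of_injective_algebraMap (algebraMap (ZMod p) k).injective p
  obtain ⟨φ, ψ, l, hl, hφ, hψ, hφl, hψl⟩ := exists_injective_pair_apply_eq_diag2 htr hx
    (surfaceRelator_ne_one hm) (inv_ne_one.mpr (surfaceRelator_ne_one hn))
  have hy₀ := ne_zero_of_transcendental hy
  have hrel : twist k hy₀ 0 (φ (surfaceRelator m)) * twist k hy₀ 1 (ψ (surfaceRelator n)) = 1 := by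
    rw [mul_eq_one_iff_eq_inv, ← map_inv, ← map_inv, hφl, hψl, twist_diag2, twist_diag2]
  obtain ⟨ρ, hleft, hright⟩ := SurfaceGroup.exists_lift
    (φ := (twist k hy₀ 0).comp φ) (ψ := (twist k hy₀ 1).comp ψ) hrel
  exact ⟨ρ, fun w => SurfaceGroup.eq_one_of_apply_mem_center p hy hy₀ hm hn hφ hψ hφl hψl
    hleft hright⟩

end Representation

section Descent

variable {R Ω n G : Type*} [Field R] [Field Ω] [Algebra R Ω] [Fintype n] [DecidableEq n] [Group G]

lemma exists_finiteDimensional_map_comp_eq [Algebra.IsAlgebraic R Ω] [Group.FG G]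
    (ρ : G →* Matrix.SpecialLinearGroup n Ω) :
    ∃ K : IntermediateField R Ω, FiniteDimensional R K ∧
      ∃ ρ' : G →* Matrix.SpecialLinearGroup n K,
        (Matrix.SpecialLinearGroup.map (algebraMap K Ω)).comp ρ' = ρ := by
  obtain ⟨T, hT⟩ := Group.FG.out (G := G)
  let entries : Set Ω := Set.range fun q : T × n × n => (ρ q.1).1 q.2.1 q.2.2
  let K := IntermediateField.adjoin R entries
  let ι := Matrix.SpecialLinearGroup.map (n := n) (algebraMap K Ω)
  have hι : Function.Injective ι := specialLinearGroup_map_injective (algebraMap K Ω).injective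
  have hgen (t : T) : ρ t ∈ ι.range := by
    let M : Matrix n n K := Matrix.of fun i j =>
      ⟨(ρ t).1 i j, IntermediateField.subset_adjoin _ _ ⟨(t, i, j), rfl⟩⟩
    have hM : (algebraMap K Ω).mapMatrix M = (ρ t).1 := rfl
    have hdet : M.det = 1 := (algebraMap K Ω).injective <| by
      rw [RingHom.map_det, hM, (ρ t).2, map_one]
    exact ⟨⟨M, hdet⟩, Subtype.ext hM⟩
  have hrange (g : G) : ρ g ∈ ι.range := by
    have hle : Subgroup.closure T ≤ ι.range.comap ρ :=
      (Subgroup.closure_le _).mpr fun t ht => hgen ⟨t, ht⟩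
    exact hle (hT ▸ Subgroup.mem_top g)
  refine ⟨K, IntermediateField.finiteDimensional_adjoin fun s _ =>
    Algebra.IsIntegral.isIntegral s,
    (MonoidHom.ofInjective hι).symm.toMonoidHom.comp (ρ.codRestrict ι.range hrange), ?_⟩
  ext1 g
  exact congrArg Subtype.val ((MonoidHom.ofInjective hι).apply_symm_apply ⟨ρ g, hrange g⟩)

lemma map_mem_center {A B : Type*} [CommRing A] [CommRing B] (f : A →+* B)
    {M : Matrix.SpecialLinearGroup n A} (hM : M ∈ Subgroup.center (Matrix.SpecialLinearGroup n A)) :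
    Matrix.SpecialLinearGroup.map f M ∈ Subgroup.center (Matrix.SpecialLinearGroup n B) := by
  obtain ⟨r, hr, hrM⟩ := Matrix.SpecialLinearGroup.mem_center_iff.mp hM
  refine Matrix.SpecialLinearGroup.mem_center_iff.mpr ⟨f r, by rw [← map_pow, hr, map_one], ?_⟩
  rw [Matrix.SpecialLinearGroup.map_apply_coe, ← hrM, RingHom.mapMatrix_apply,
    Matrix.scalar_apply, Matrix.scalar_apply, Matrix.diagonal_map (map_zero f)]

theorem exists_finiteDimensional_injective_projGenLinGroup [Algebra.IsAlgebraic R Ω] [Group.FG G]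
    {ρ : G →* Matrix.SpecialLinearGroup n Ω}
    (hρ : ∀ w, ρ w ∈ Subgroup.center (Matrix.SpecialLinearGroup n Ω) → w = 1) :
    ∃ K : IntermediateField R Ω, FiniteDimensional R K ∧
      ∃ ρ' : G →* Matrix.ProjGenLinGroup n K, Function.Injective ρ' := by
  obtain ⟨K, hK, ρ', rfl⟩ := exists_finiteDimensional_map_comp_eq (R := R) ρ
  refine ⟨K, hK, Matrix.SpecialLinearGroup.toPGL.comp ρ', ?_⟩
  refine (injective_iff_map_eq_one _).mpr fun w hw => hρ w (map_mem_center _ ?_)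
  rwa [← Matrix.SpecialLinearGroup.toPGL_ker]

end Descent

instance SurfaceGroup.fg (g : ℕ) : Group.FG (SurfaceGroup g) :=
  Group.fg_of_surjective (PresentedGroup.mk_surjective _)

section RationalFunctionField

lemma algebraicIndependent_algebraMap_X (σ R A : Type*) [CommRing R] [CommRing A] [Algebra R A]
    [Algebra (MvPolynomial σ R) A] [IsScalarTower R (MvPolynomial σ R) A]
    [FaithfulSMul (MvPolynomial σ R) A] :
    AlgebraicIndependent R fun i => algebraMap (MvPolynomial σ R) A (MvPolynomial.X i) :=
  (MvPolynomial.algebraicIndependent_X σ R).map' (f := IsScalarTower.toAlgHom R _ A)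
    (FaithfulSMul.algebraMap_injective _ A)

end RationalFunctionField

theorem mainTheorem1_general (p : ℕ) [Fact p.Prime] (g : ℕ) (hg : 2 ≤ g) :
    ∃ (K : Type) (_ : Field K) (_ : Algebra (RationalFunctionField₂ p) K),
      FiniteDimensional (RationalFunctionField₂ p) K ∧
        ∃ ρ : SurfaceGroup g →* Matrix.ProjGenLinGroup (Fin 2) K, Function.Injective ρ := by
  let Ω := AlgebraicClosure (RationalFunctionField₂ p)
  have : FaithfulSMul (MvPolynomial (Fin 2) (ZMod p)) Ω :=
    FaithfulSMul.trans _ (RationalFunctionField₂ p) _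
  obtain ⟨k, _, htr, ⟨x, hx⟩, hy⟩ := exists_isAlgClosed_trdeg_le_one
    (algebraicIndependent_algebraMap_X (Fin 2) (ZMod p) Ω)
  obtain ⟨n, rfl⟩ : ∃ n, g = 1 + (n + 1) := ⟨g - 2, by lia⟩
  obtain ⟨ρ, hρ⟩ := exists_surfaceGroup_hom htr hx hy one_ne_zero n.succ_ne_zero
  obtain ⟨K, hK, ρ', hρ'⟩ :=
    exists_finiteDimensional_injective_projGenLinGroup (R := RationalFunctionField₂ p) hρ
  exact ⟨K, inferInstance, inferInstance, hK, ρ', hρ'⟩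

theorem mainTheorem1 (p : ℕ) [Fact p.Prime] (hp : 5 ≤ p) (g : ℕ) (hg : 2 ≤ g) :
    ∃ (K : Type) (_ : Field K) (_ : Algebra (RationalFunctionField₂ p) K),
      FiniteDimensional (RationalFunctionField₂ p) K ∧
        ∃ ρ : SurfaceGroup g →* Matrix.ProjGenLinGroup (Fin 2) K, Function.Injective ρ :=
  mainTheorem1_general p g hg
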